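/- Call an Abelian topological group $G$ reflexive if the evaluation homomorphism $\alpha_G\colon G\to G^{\wedge\wedge}$, $\alpha_G(x)(\chi)=\chi(x)$, is a topological isomorphism of $G$ onto $G^{\wedge\wedge}$; here $G^\wedge$ denotes the group of continuous homomorphisms of $G$ to the circle group $\mathbb T$, with pointwise multiplication and the compact-open topology, and $G^{\wedge\wedge}=(G^\wedge)^\wedge$. A $P$-group is a topological group in which every $G_\delta$-set is open. Let $H$ be a closed subgroup of an Abelian topological group $G$. If $H$ (with the subspace topology) and $G/H$ (with the quotient topology) are both reflexive $P$-groups, then $G$ is a reflexive $P$-group. -/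

import Mathlib

/-- The evaluation homomorphism `α_G : G → G^∧∧`, `α_G(x)(χ) = χ(x)`, where `G^∧` is the group of
continuous homomorphisms from `G` to the circle group with the compact-open topology. -/
noncomputable def bidualEval (G : Type*) [CommGroup G] [TopologicalSpace G] :
    G →* PontryaginDual (PontryaginDual G) where
  toFun x :=
    { toFun := fun χ : PontryaginDual G => χ x
      map_one' := rfl
      map_mul' := fun _ _ => rfl
      continuous_toFun := continuous_eval_const (F := G →ₜ* Circle) x }
  map_one' := PontryaginDual.ext fun χ => map_one χ
  map_mul' x y := PontryaginDual.ext fun χ => map_mul χ x y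

theorem bidualEval_apply {G : Type*} [CommGroup G] [TopologicalSpace G] (x : G)
    (χ : PontryaginDual G) : bidualEval G x χ = χ x := rfl

/-- An abelian topological group is (Pontryagin) reflexive if the evaluation homomorphism is a
topological isomorphism onto the bidual group. -/
def IsReflexiveGroup (G : Type*) [CommGroup G] [TopologicalSpace G] : Prop :=
  IsHomeomorph (bidualEval G)

/-- A `P`-space is a topological space in which every `G_δ`-set is open. A topological group is a
`P`-group if its underlying space is a `P`-space. -/
def IsPSpace (X : Type*) [TopologicalSpace X] : Prop :=
  ∀ s : Set X, IsGδ s → IsOpen s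

/-- A reflexive `P`-group: an abelian topological group that is reflexive and whose underlying
space is a `P`-space. -/
def IsReflexivePGroup (G : Type*) [CommGroup G] [TopologicalSpace G] [IsTopologicalGroup G] :
    Prop :=
  IsReflexiveGroup G ∧ IsPSpace G

open Topology Set Filter

/-! A Hausdorff `P`-group has only finite compact subsets, so its dual carries the pointwise
topology, and evaluation is automatically injective, surjective and open. Reflexivity thus reduces
to continuity of evaluation, which is equivalent to `HasLocallyTrivialCompacts`, since open
subgroups form a base at 1 and the circle has no small subgroups.

This condition passes to extensions. Restrict a compact set `K` of characters of `G` to `H`; all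
restrictions die on one open subgroup of `H`, so some open `U ≤ G` has every `κ ∈ K` trivial on `U ∩
H`. Then `κ` on `U` descends to the image of `U` in `G ⧸ H` and extends to `G ⧸ H` by divisibility
of the circle. The extensions form a compact set, hence die on one open subgroup, whose preimage
meets `U` in an open subgroup killing `K`. -/

/-! ### Extension and separation by abstract characters -/

/-- The circle group is divisible, hence injective among abelian groups. -/
theorem baer_additive_circle : Module.Baer ℤ (Additive Circle) := by
  let _ : DivisibleBy (Additive Circle) ℤ :=
    Function.Surjective.divisibleBy (α := ℤ) Circle.expHom
      (fun z => (Circle.exp_surjective z.toMul)) fun a n => map_zsmul Circle.expHom n a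
  exact Module.Baer.of_divisible _

/-- A homomorphism into the circle extends along an injective homomorphism. -/
theorem MonoidHom.exists_circle_extension {A B : Type*} [CommGroup A] [CommGroup B] (j : A →* B)
    (hj : Function.Injective j) (f : A →* Circle) : ∃ g : B →* Circle, ∀ a, g (j a) = f a := by
  obtain ⟨g, hg⟩ := baer_additive_circle.extension_property_addMonoidHom
    (MonoidHom.toAdditive j) hj (MonoidHom.toAdditive f)
  exact ⟨MonoidHom.toAdditive.symm g, fun a => DFunLike.congr_fun hg (Additive.ofMul a)⟩

/-- A homomorphism into the circle trivial on the kernel of `j` extends along `j`. -/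
theorem MonoidHom.exists_circle_extension_of_ker_le {A B : Type*} [CommGroup A] [CommGroup B]
    (j : A →* B) (f : A →* Circle) (h : j.ker ≤ f.ker) :
    ∃ g : B →* Circle, ∀ a, g (j a) = f a := by
  obtain ⟨g, hg⟩ := MonoidHom.exists_circle_extension (QuotientGroup.kerLift j)
    (QuotientGroup.kerLift_injective j) (QuotientGroup.lift j.ker f h)
  exact ⟨g, fun a => hg (a : A ⧸ j.ker)⟩

/-- Characters separate the points of an abelian group. -/
theorem exists_monoidHom_circle_ne_one {B : Type*} [CommGroup B] {b : B} (hb : b ≠ 1) :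
    ∃ f : B →* Circle, f b ≠ 1 := by
  obtain ⟨c, hc⟩ := CharacterModule.exists_character_apply_ne_zero_of_ne_zero
    (A := Additive B) (a := Additive.ofMul b) hb
  let e : ℚ →+ Additive Circle :=
    Circle.expHom.comp ((AddMonoidHom.mulLeft (2 * Real.pi)).comp (Rat.castHom ℝ).toAddMonoidHom)
  have he (q : ℚ) : e q = Additive.ofMul (Circle.exp (2 * Real.pi * q)) := rfl
  have hker (q : ℚ) : e q = 0 ↔ q ∈ AddSubgroup.zmultiples (1 : ℚ) := by
    rw [he, ofMul_eq_zero, Circle.exp_eq_one, AddSubgroup.mem_zmultiples_iff]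
    refine exists_congr fun n => ?_
    rw [mul_comm, mul_left_inj' Real.two_pi_pos.ne', zsmul_one]
    exact_mod_cast eq_comm
  let e' : AddCircle (1 : ℚ) →+ Additive Circle :=
    QuotientAddGroup.lift _ e fun q hq => (hker q).2 hq
  have he' (x : AddCircle (1 : ℚ)) (hx : e' x = 0) : x = 0 := by
    induction x using QuotientAddGroup.induction_on with
    | H q => exact (QuotientAddGroup.eq_zero_iff q).2 ((hker q).1 hx)
  let c' : Additive B →+ AddCircle (1 : ℚ) := c
  exact ⟨MonoidHom.toAdditive.symm (e'.comp c'), fun h => hc (he' _ h)⟩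

/-- Characters separate the points of an abelian group from a subgroup. -/
theorem Subgroup.exists_monoidHom_circle_ne_one {B : Type*} [CommGroup B] (U : Subgroup B) {b : B}
    (hb : b ∉ U) : ∃ f : B →* Circle, (∀ u ∈ U, f u = 1) ∧ f b ≠ 1 := by
  obtain ⟨f, hf⟩ := _root_.exists_monoidHom_circle_ne_one
    (b := (b : B ⧸ U)) (fun h => hb ((QuotientGroup.eq_one_iff b).1 h))
  refine ⟨f.comp (QuotientGroup.mk' U), fun u hu => ?_, hf⟩
  simp [(QuotientGroup.eq_one_iff u).2 hu]

/-! ### Characters of compact groups and duality for discrete groups -/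

/-- The integral of a nontrivial character of a compact group vanishes. -/
theorem integral_character_eq_zero {C : Type*} [CommGroup C] [TopologicalSpace C]
    [IsTopologicalGroup C] [CompactSpace C] [MeasurableSpace C] [BorelSpace C]
    (μ : MeasureTheory.Measure C) [μ.IsMulLeftInvariant] (χ : C →* Circle) {c : C}
    (hc : χ c ≠ 1) : ∫ x, (χ x : ℂ) ∂μ = 0 := by
  have h := MeasureTheory.integral_mul_left_eq_self (μ := μ) (fun x => (χ x : ℂ)) c
  simp only [map_mul, Circle.coe_mul, MeasureTheory.integral_const_mul] at h
  have h2 : ((χ c : ℂ) - 1) * ∫ x, (χ x : ℂ) ∂μ = 0 := by rw [sub_mul, h]; ring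
  refine (mul_eq_zero.1 h2).resolve_left fun h3 => hc ?_
  exact Circle.ext (by simpa [sub_eq_zero] using h3)

/-- On a compact group, a continuous character lies in every point-separating group of continuous
characters. -/
theorem character_mem_of_separatesPoints {C : Type*} [CommGroup C] [TopologicalSpace C]
    [IsTopologicalGroup C] [CompactSpace C] (S : Subgroup (C →ₜ* Circle))
    (hS : ∀ x y : C, x ≠ y → ∃ χ ∈ S, χ x ≠ χ y) (ψ : C →ₜ* Circle) : ψ ∈ S := by
  by_contra hψ
  borelize C
  let μ : MeasureTheory.Measure C := MeasureTheory.Measure.haar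
  let ev : (C →ₜ* Circle) → C(C, ℂ) := fun χ =>
    ⟨fun x => (χ x : ℂ), continuous_subtype_val.comp χ.continuous_toFun⟩
  let A : StarSubalgebra ℂ C(C, ℂ) :=
    { Algebra.adjoin ℂ (ev '' S) with
      star_mem' := by
        change Algebra.adjoin ℂ (ev '' S) ≤ star (Algebra.adjoin ℂ (ev '' S))
        refine Algebra.adjoin_le ?_
        rintro - ⟨χ, hχ, rfl⟩
        refine Algebra.subset_adjoin ⟨χ⁻¹, inv_mem hχ, ?_⟩
        ext x
        exact Circle.coe_inv_eq_conj (χ x) }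
  have hA : Subalgebra.toSubmodule A.toSubalgebra = Submodule.span ℂ (ev '' S) := by
    apply Algebra.adjoin_eq_span_of_subset
    refine Subset.trans ?_ Submodule.subset_span
    intro x hx
    refine Submonoid.closure_induction (fun _ => id) ⟨1, one_mem S, ?_⟩ ?_ hx
    · ext1 z; exact Circle.coe_one
    · rintro - - - - ⟨m, hm, rfl⟩ ⟨n, hn, rfl⟩
      refine ⟨m * n, mul_mem hm hn, ?_⟩
      ext1 z
      exact Circle.coe_mul _ _
  have hsep : A.SeparatesPoints := by
    intro x y hxy
    obtain ⟨χ, hχ, h⟩ := hS x y hxy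
    exact ⟨_, ⟨ev χ, Algebra.subset_adjoin ⟨χ, hχ, rfl⟩, rfl⟩, fun h' => h (Circle.ext h')⟩
  have htop := ContinuousMap.starSubalgebra_topologicalClosure_eq_top_of_separatesPoints A hsep
  have hint (f : C(C, ℂ)) : MeasureTheory.Integrable f μ :=
    f.continuous.integrable_of_hasCompactSupport (HasCompactSupport.of_compactSpace f)
  -- Pairing with `ψ`: orthogonality kills the span of `S`, dense by Stone–Weierstrass, yet `ψ`
  -- pairs with itself to the total mass.
  let I : C(C, ℂ) →ₗ[ℂ] ℂ :=
    { toFun := fun f => ∫ x, (ev ψ⁻¹ * f) x ∂μ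
      map_add' := fun f g => by
        rw [mul_add]
        exact MeasureTheory.integral_add (hint _) (hint _)
      map_smul' := fun c f => by
        rw [mul_smul_comm]
        exact MeasureTheory.integral_smul c _ }
  have hIc : Continuous I := by
    have h1 : Continuous fun f : C(C, ℂ) => ∫ x, f x ∂μ := by
      refine (MeasureTheory.continuous_integral.comp
        (ContinuousMap.toLp (E := ℂ) 1 μ ℂ).continuous).congr fun f => ?_
      exact MeasureTheory.integral_congr_ae (ContinuousMap.coeFn_toLp (𝕜 := ℂ) μ f)
    exact h1.comp (continuous_const.mul continuous_id)
  have hZ : Subalgebra.toSubmodule A.toSubalgebra ≤ LinearMap.ker I := by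
    rw [hA, Submodule.span_le]
    rintro - ⟨χ, hχ, rfl⟩
    obtain ⟨c, hc⟩ : ∃ c, (ψ⁻¹ * χ) c ≠ 1 := by
      by_contra! h
      exact hψ ((inv_mul_eq_one.1 (ContinuousMonoidHom.ext h : ψ⁻¹ * χ = 1)) ▸ hχ)
    exact integral_character_eq_zero μ (ψ⁻¹ * χ : C →ₜ* Circle).toMonoidHom hc
  have hψZ : I (ev ψ) = 0 := by
    have hmem : ev ψ ∈ A.topologicalClosure := htop ▸ trivial
    exact closure_minimal (s := (A : Set C(C, ℂ))) (t := {f | I f = 0}) hZ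
      (isClosed_eq hIc continuous_const) hmem
  have h1 : ev ψ⁻¹ * ev ψ = 1 := by
    ext x
    change ((ψ x)⁻¹ : Circle) * (ψ x : ℂ) = 1
    rw [← Circle.coe_mul, inv_mul_cancel, Circle.coe_one]
  have h2 : I (ev ψ) = ∫ x, (ev ψ⁻¹ * ev ψ) x ∂μ := rfl
  rw [h2, h1] at hψZ
  simp [MeasureTheory.measureReal_eq_zero_iff] at hψZ
  exact NeZero.ne μ hψZ

/-- The continuous characters of the dual of a discrete abelian group are the evaluations. -/
theorem bidualEval_surjective_of_discrete (B : Type*) [CommGroup B] [TopologicalSpace B]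
    [DiscreteTopology B] : Function.Surjective (bidualEval B) := by
  intro ψ
  have := character_mem_of_separatesPoints (C := PontryaginDual B) (bidualEval B).range
    (fun x y hxy => ?_) ψ
  · exact this
  · obtain ⟨b, hb⟩ : ∃ b, x b ≠ y b := by
      by_contra! h
      exact hxy (PontryaginDual.ext h)
    exact ⟨_, ⟨b, rfl⟩, hb⟩

/-! ### `P`-spaces and `P`-groups -/

theorem IsPSpace.iInter_mem_nhds {X ι : Type*} [TopologicalSpace X] [Countable ι]
    (hX : IsPSpace X) {x : X} {s : ι → Set X} (hs : ∀ i, s i ∈ 𝓝 x) : ⋂ i, s i ∈ 𝓝 x := by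
  refine mem_of_superset (IsOpen.mem_nhds (hX (⋂ i, interior (s i)) ?_) ?_)
    (iInter_mono fun i => interior_subset)
  · exact IsGδ.iInter fun i => isOpen_interior.isGδ
  · exact mem_iInter.2 fun i => mem_interior_iff_mem_nhds.2 (hs i)

theorem IsPSpace.isClosed_of_countable {X : Type*} [TopologicalSpace X] [T1Space X]
    (hX : IsPSpace X) {s : Set X} (hs : s.Countable) : IsClosed s := by
  rw [← isOpen_compl_iff]
  exact hX _ hs.isGδ_compl

/-- Compact subsets of a `T₁` `P`-space are finite. -/
theorem IsPSpace.finite_of_isCompact {X : Type*} [TopologicalSpace X] [T1Space X]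
    (hX : IsPSpace X) {K : Set X} (hK : IsCompact K) : K.Finite := by
  by_contra hinf
  -- A countable infinite subset would be closed and discrete, hence compact and finite.
  let e := Set.Infinite.natEmbedding K hinf
  let S : Set X := range fun n => (e n : X)
  have hSK : S ⊆ K := by rintro - ⟨n, rfl⟩; exact (e n).2
  have hSc : S.Countable := countable_range _
  have hS : IsCompact S := hK.of_isClosed_subset (hX.isClosed_of_countable hSc) hSK
  have hd : IsDiscrete S := by
    refine ⟨discreteTopology_iff_forall_isClosed.2 fun t => ?_⟩
    have : IsClosed ((↑) '' t : Set X) := hX.isClosed_of_countable (hSc.mono (by simp))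
    have h := this.preimage (continuous_subtype_val (p := (· ∈ S)))
    rwa [preimage_image_eq _ Subtype.val_injective] at h
  exact infinite_range_of_injective (Subtype.val_injective.comp e.injective) (hS.finite hd)

/-- Every neighbourhood of the identity in a `P`-group contains an open subgroup. -/
theorem IsPSpace.exists_openSubgroup_subset {G : Type*} [Group G] [TopologicalSpace G]
    [IsTopologicalGroup G] (hG : IsPSpace G) {s : Set G} (hs : s ∈ 𝓝 (1 : G)) :
    ∃ U : OpenSubgroup G, (U : Set G) ⊆ s := by
  obtain ⟨V, hV, hV1⟩ : ∃ V : ℕ → Set G, (∀ n, V n ∈ 𝓝 (1 : G)) ∧ V 0 ⊆ s ∧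
      ∀ n, ∀ x ∈ V (n + 1), ∀ y ∈ V (n + 1), x / y ∈ V n := by
    have step (W : {W : Set G // W ∈ 𝓝 (1 : G)}) : ∃ W' : {W : Set G // W ∈ 𝓝 (1 : G)},
        ∀ x ∈ W'.1, ∀ y ∈ W'.1, x / y ∈ W.1 := by
      obtain ⟨W', h1, h2⟩ := exists_nhds_split_inv W.2
      exact ⟨⟨W', h1⟩, h2⟩
    choose f hf using step
    let V (n : ℕ) : {W : Set G // W ∈ 𝓝 (1 : G)} := f^[n] ⟨s, hs⟩
    refine ⟨fun n => (V n).1, fun n => (V n).2, subset_rfl, fun n => ?_⟩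
    simp only [V, Function.iterate_succ_apply']
    exact hf _
  have h1 (n : ℕ) : (1 : G) ∈ V n := mem_of_mem_nhds (hV n)
  have hinv (n : ℕ) {x : G} (hx : x ∈ V (n + 1)) : x⁻¹ ∈ V n := by
    simpa using hV1.2 n 1 (h1 _) x hx
  let U : Subgroup G :=
    { carrier := ⋂ n, V n
      one_mem' := mem_iInter.2 h1
      mul_mem' := fun {x y} hx hy => mem_iInter.2 fun n => by
        simpa using hV1.2 n x (mem_iInter.1 hx _) y⁻¹ (hinv _ (mem_iInter.1 hy _))
      inv_mem' := fun {x} hx => mem_iInter.2 fun n => hinv n (mem_iInter.1 hx _) }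
  exact ⟨⟨U, U.isOpen_of_mem_nhds (g := 1) (hG.iInter_mem_nhds hV)⟩,
    (iInter_subset V 0).trans hV1.1⟩

/-- A topological group is a `P`-space as soon as countable intersections of neighbourhoods of the
identity are neighbourhoods of the identity. -/
theorem isPSpace_of_iInter_mem_nhds_one {G : Type*} [Group G] [TopologicalSpace G]
    [IsTopologicalGroup G]
    (h : ∀ s : ℕ → Set G, (∀ n, s n ∈ 𝓝 (1 : G)) → ⋂ n, s n ∈ 𝓝 (1 : G)) : IsPSpace G := by
  intro s hs
  obtain ⟨f, hf, rfl⟩ := isGδ_iff_eq_iInter_nat.1 hs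
  refine isOpen_iff_mem_nhds.2 fun x hx => ?_
  have hc : Tendsto (fun y => x⁻¹ * y) (𝓝 x) (𝓝 1) := by
    simpa using (continuous_const_mul x⁻¹).tendsto x
  have hd : Tendsto (fun y => x * y) (𝓝 1) (𝓝 x) := by
    simpa using (continuous_const_mul x).tendsto 1
  have := hc (h (fun n => (fun y => x * y) ⁻¹' f n)
    fun n => hd ((hf n).mem_nhds (mem_iInter.1 hx n)))
  simpa only [← preimage_iInter, ← preimage_comp, Function.comp_def, mul_inv_cancel_left,
    preimage_id', mem_map] using this

/-- An extension of a `P`-group by a `P`-group is a `P`-group. -/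
theorem isPSpace_of_subgroup_of_quotient {G : Type*} [CommGroup G] [TopologicalSpace G]
    [IsTopologicalGroup G] (H : Subgroup G) (hH : IsPSpace H) (hQ : IsPSpace (G ⧸ H)) :
    IsPSpace G := by
  refine isPSpace_of_iInter_mem_nhds_one fun s hs => ?_
  choose t ht hts using fun n => exists_nhds_split_inv (hs n)
  choose r hr hrt using fun n => exists_nhds_split_inv (ht n)
  have hH1 : ⋂ n, ((↑) ⁻¹' r n : Set H) ∈ 𝓝 (1 : H) :=
    hH.iInter_mem_nhds fun n => continuous_subtype_val.continuousAt (hr n)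
  obtain ⟨V, hV, hVr⟩ := mem_nhds_subtype _ _ _ |>.1 hH1
  obtain ⟨W, hW, hWV⟩ := exists_nhds_split_inv hV
  have hO : ⋂ n, ((↑) '' (W ∩ r n) : Set (G ⧸ H)) ∈ 𝓝 (1 : G ⧸ H) :=
    hQ.iInter_mem_nhds fun n =>
      QuotientGroup.isOpenMap_coe.image_mem_nhds (inter_mem hW (hr n))
  have hO' : ((↑) : G → G ⧸ H) ⁻¹' ⋂ n, ((↑) '' (W ∩ r n) : Set (G ⧸ H)) ∈ 𝓝 (1 : G) :=
    QuotientGroup.continuous_mk.continuousAt hO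
  -- One `W` serves all `n`: `x / w` lies in `H ∩ V`, hence in every `r n`, although `w` varies with
  -- `n`.
  filter_upwards [hW, hO'] with x hxW hx
  refine mem_iInter.2 fun n => ?_
  obtain ⟨w, ⟨hwW, hwr⟩, hwx⟩ := mem_iInter.1 hx n
  have hh : x / w ∈ H := by
    rw [div_eq_inv_mul]
    exact QuotientGroup.eq.1 hwx
  have hxr : x / w ∈ r n := mem_iInter.1 (@hVr ⟨x / w, hh⟩ (hWV x hxW w hwW)) n
  have h1r : (1 : G) ∈ r n := mem_of_mem_nhds (hr n)
  have h1 : (1 / w : G) ∈ t n := hrt n 1 h1r w hwr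
  have h2 : x / w ∈ t n := by simpa using hrt n _ hxr 1 h1r
  simpa using hts n _ h2 _ h1

theorem t2Space_of_isClosed_subgroup {G : Type*} [Group G] [TopologicalSpace G]
    [IsTopologicalGroup G] (H : Subgroup G) (hH : IsClosed (H : Set G)) [T1Space H] :
    T2Space G := by
  have h : IsClosed ({1} : Set G) := by
    simpa using hH.isClosedEmbedding_subtypeVal.isClosedMap {(1 : H)} isClosed_singleton
  have : T1Space G := IsTopologicalGroup.t1Space G h
  infer_instance

/-! ### Duals and biduals of `P`-groups -/

/-- On the dual of a `T₁` `P`-group the compact-open topology is that of pointwise convergence. -/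
theorem PontryaginDual.isEmbedding_coe_of_isPSpace {G : Type*} [CommGroup G] [TopologicalSpace G]
    [T1Space G] (hG : IsPSpace G) :
    IsEmbedding (fun (χ : PontryaginDual G) (x : G) => χ x) := by
  refine ⟨isInducing_iff _ |>.2 (le_antisymm ?_ ?_), fun χ χ' h => PontryaginDual.ext (congrFun h)⟩
  · exact continuous_iff_le_induced.1
      (continuous_pi fun x => continuous_eval_const (F := G →ₜ* Circle) x)
  · refine continuous_id_iff_le.1 (?_ : @Continuous _ _ (_) (_) id)
    refine continuous_induced_rng.2 ?_
    let _ : TopologicalSpace (PontryaginDual G) :=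
      TopologicalSpace.induced (fun (χ : PontryaginDual G) (x : G) => χ x) inferInstance
    have hc (x : G) : Continuous fun χ : PontryaginDual G => χ x :=
      (continuous_apply x).comp continuous_induced_dom
    refine ContinuousMap.continuous_compactOpen.2 fun K hK V hV => ?_
    have : {χ : PontryaginDual G | MapsTo χ K V} = ⋂ x ∈ K, (fun χ => χ x) ⁻¹' V := by
      ext χ; simp [MapsTo]
    change IsOpen {χ : PontryaginDual G | MapsTo χ K V}
    rw [this]
    exact (hG.finite_of_isCompact hK).isOpen_biInter fun x _ => hV.preimage (hc x)

/-- The radius `π / 2` matters: this arc contains no nontrivial subgroup. -/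
theorem circle_arc_mem_nhds_one : Circle.centeredArc (Real.pi / 2) ∈ 𝓝 (1 : Circle) := by
  refine (Circle.isOpen_centeredArc _).mem_nhds ?_
  rw [Circle.mem_centeredArc (by linarith [Real.pi_pos])]
  simp [Real.pi_pos]

/-- The characters of `G ⧸ U` viewed as characters of `G`. -/
noncomputable def quotientDualMap {G : Type*} [CommGroup G] [TopologicalSpace G]
    [IsTopologicalGroup G] (U : Subgroup G) : PontryaginDual (G ⧸ U) →ₜ* PontryaginDual G :=
  PontryaginDual.map ⟨QuotientGroup.mk' U, QuotientGroup.continuous_mk⟩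

/-- A homomorphism from a discrete group to the circle as an element of the dual. -/
def PontryaginDual.ofDiscrete {B : Type*} [CommGroup B] [TopologicalSpace B] [DiscreteTopology B]
    (f : B →* Circle) : PontryaginDual B :=
  (⟨f, continuous_of_discreteTopology⟩ : B →ₜ* Circle)

/-- Continuous characters separate points from open subgroups. -/
theorem OpenSubgroup.exists_pontryaginDual_ne_one {G : Type*} [CommGroup G] [TopologicalSpace G]
    [IsTopologicalGroup G] (U : OpenSubgroup G) {x : G} (hx : x ∉ U) :
    ∃ χ : PontryaginDual (G ⧸ (U : Subgroup G)), quotientDualMap (U : Subgroup G) χ x ≠ 1 := by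
  obtain ⟨f, hf⟩ := exists_monoidHom_circle_ne_one
    (b := (x : G ⧸ (U : Subgroup G))) (fun h => hx ((QuotientGroup.eq_one_iff x).1 h))
  exact ⟨PontryaginDual.ofDiscrete f, hf⟩

theorem bidualEval_injective_of_isPSpace {G : Type*} [CommGroup G] [TopologicalSpace G]
    [IsTopologicalGroup G] [T1Space G] (hG : IsPSpace G) : Function.Injective (bidualEval G) := by
  refine (injective_iff_map_eq_one _).2 fun x hx => ?_
  by_contra hne
  obtain ⟨U, hU⟩ := hG.exists_openSubgroup_subset (isOpen_ne.mem_nhds (Ne.symm hne))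
  obtain ⟨χ, hχ⟩ := U.exists_pontryaginDual_ne_one (x := x) fun h => hU h rfl
  exact hχ (DFunLike.congr_fun hx (quotientDualMap (U : Subgroup G) χ))

/-- A continuous character of the dual of a `T₁` `P`-group depends on finitely many coordinates. -/
theorem exists_finite_of_bidual {G : Type*} [CommGroup G] [TopologicalSpace G]
    [IsTopologicalGroup G] [T1Space G] (hG : IsPSpace G) (ψ : PontryaginDual (PontryaginDual G)) :
    ∃ F : Set G, F.Finite ∧ ∀ χ : PontryaginDual G, (∀ x ∈ F, χ x = 1) → ψ χ = 1 := by
  have h1 : ψ ⁻¹' Circle.centeredArc (Real.pi / 2) ∈ 𝓝 (1 : PontryaginDual G) :=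
    (map_continuous ψ).continuousAt (by rw [map_one]; exact circle_arc_mem_nhds_one)
  rw [(PontryaginDual.isEmbedding_coe_of_isPSpace hG).nhds_eq_comap, mem_comap] at h1
  obtain ⟨t, ht, hts⟩ := h1
  rw [nhds_pi, Filter.mem_pi] at ht
  obtain ⟨F, hF, s, hs, hst⟩ := ht
  refine ⟨F, hF, fun χ hχ => Circle.eq_one_of_forall_pow_mem_centeredArc_pi_div_two fun n _ => ?_⟩
  rw [← map_pow]
  refine hts (hst fun x hx => ?_)
  have : (χ ^ n) x = (χ x) ^ n := map_pow (bidualEval G x) χ n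
  change (χ ^ n) x ∈ s x
  rw [this, hχ x hx, one_pow]
  exact mem_of_mem_nhds (hs x)

/-- The continuous characters of the dual of a `T₁` `P`-group are the evaluations. -/
theorem bidualEval_surjective_of_isPSpace {G : Type*} [CommGroup G] [TopologicalSpace G]
    [IsTopologicalGroup G] [T1Space G] (hG : IsPSpace G) :
    Function.Surjective (bidualEval G) := by
  intro ψ
  obtain ⟨F, hF, hψ⟩ := exists_finite_of_bidual hG ψ
  let A : Subgroup G := Subgroup.closure F
  have : Countable F := hF.countable
  have hAc : Countable A := by
    have : Countable (FreeGroup F) := Quot.mk_surjective.countable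
    have hr : (FreeGroup.lift ((↑) : F → G)).range = A := by
      rw [FreeGroup.range_lift_eq_closure, Subtype.range_coe]
    exact hr ▸ (FreeGroup.lift ((↑) : F → G)).rangeRestrict_surjective.countable
  -- Countable sets are closed, so some open subgroup meets `A` only in 1 and `A` embeds in a
  -- discrete quotient.
  have hA : ((A : Set G) \ {1})ᶜ ∈ 𝓝 (1 : G) :=
    (hG.isClosed_of_countable
      ((Set.to_countable (A : Set G)).mono sdiff_subset)).isOpen_compl.mem_nhds (by simp)
  obtain ⟨U, hU⟩ := hG.exists_openSubgroup_subset hA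
  let π : G →* G ⧸ (U : Subgroup G) := QuotientGroup.mk' _
  let j : A →* G ⧸ (U : Subgroup G) := π.comp A.subtype
  have hj : Function.Injective j := by
    refine (injective_iff_map_eq_one _).2 fun a ha => ?_
    by_contra hne
    exact hU ((QuotientGroup.eq_one_iff (a : G)).1 ha) ⟨a.2, fun h => hne (Subtype.ext h)⟩
  obtain ⟨b, hb⟩ := bidualEval_surjective_of_discrete _
    (ψ.comp (quotientDualMap (U : Subgroup G)) : PontryaginDual (G ⧸ (U : Subgroup G)) →ₜ* Circle)
  have hb' (χ : PontryaginDual (G ⧸ (U : Subgroup G))) :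
      ψ (quotientDualMap (U : Subgroup G) χ) = χ b := (DFunLike.congr_fun hb χ).symm
  -- Otherwise a character trivial on `A` but not at `b` contradicts the choice of `F`.
  have hbA : b ∈ j.range := by
    by_contra hbA
    obtain ⟨f, hf, hfb⟩ := j.range.exists_monoidHom_circle_ne_one hbA
    refine hfb ((hb' (PontryaginDual.ofDiscrete f)).symm.trans (hψ _ fun x hx => ?_))
    exact hf _ ⟨⟨x, Subgroup.subset_closure hx⟩, rfl⟩
  obtain ⟨a, rfl⟩ := hbA
  refine ⟨a, PontryaginDual.ext fun χ => ?_⟩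
  obtain ⟨g, hg⟩ := MonoidHom.exists_circle_extension j hj
    (((χ : G →ₜ* Circle) : G →* Circle).comp A.subtype)
  -- `χ'` agrees with `χ` on `A ⊇ F`, so `ψ` does not distinguish them.
  let χ' := quotientDualMap (U : Subgroup G) (PontryaginDual.ofDiscrete g)
  have h1 : ψ (χ / χ') = 1 := by
    refine hψ _ fun x hx => ?_
    have h2 : χ' x = χ x := hg ⟨x, Subgroup.subset_closure hx⟩
    have h3 : (χ / χ') x = χ x / χ' x := rfl
    rw [h3, h2, div_self']
  rw [map_div, div_eq_one] at h1
  rw [h1, hb', bidualEval_apply]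
  exact (hg a).symm

theorem bidualEval_isOpenMap_of_isPSpace {G : Type*} [CommGroup G] [TopologicalSpace G]
    [IsTopologicalGroup G] [T1Space G] (hG : IsPSpace G) : IsOpenMap (bidualEval G) := by
  refine IsTopologicalGroup.isOpenMap_iff_nhds_one.2 fun s hs => ?_
  obtain ⟨U, hU⟩ := hG.exists_openSubgroup_subset (mem_map.1 hs)
  let K : Set (PontryaginDual G) := range (quotientDualMap (U : Subgroup G))
  -- The dual of the discrete group `G ⧸ U` is compact.
  have hK : IsCompact K := isCompact_range (map_continuous _)
  have hO : IsOpen {ψ : PontryaginDual (PontryaginDual G) |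
      MapsTo ψ K (Circle.centeredArc (Real.pi / 2))} :=
    isOpen_induced (ContinuousMap.isOpen_setOfPred_mapsTo hK (Circle.isOpen_centeredArc _))
  refine mem_of_superset (hO.mem_nhds fun χ _ => mem_of_mem_nhds circle_arc_mem_nhds_one) ?_
  intro ψ hψ
  obtain ⟨x, rfl⟩ := bidualEval_surjective_of_isPSpace hG ψ
  refine hU (a := x) ?_
  by_contra hx
  obtain ⟨χ, hχ⟩ := U.exists_pontryaginDual_ne_one hx
  refine hχ (Circle.eq_one_of_forall_pow_mem_centeredArc_pi_div_two fun n _ => ?_)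
  have h := hψ (x := quotientDualMap (U : Subgroup G) (χ ^ n)) ⟨_, rfl⟩
  rwa [map_pow, map_pow] at h

/-! ### Continuity of evaluation and extensions -/

/-- Every compact set of continuous characters is trivial on a common open subgroup. -/
def HasLocallyTrivialCompacts (G : Type*) [CommGroup G] [TopologicalSpace G] : Prop :=
  ∀ K : Set (PontryaginDual G), IsCompact K → ∃ U : OpenSubgroup G, ∀ χ ∈ K, ∀ u ∈ U, χ u = 1

theorem HasLocallyTrivialCompacts.continuous_bidualEval {G : Type*} [CommGroup G]
    [TopologicalSpace G] [IsTopologicalGroup G] (h : HasLocallyTrivialCompacts G) :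
    Continuous (bidualEval G) := by
  refine continuous_induced_rng.2 (ContinuousMap.continuous_compactOpen.2 fun K hK V hV => ?_)
  obtain ⟨U, hU⟩ := h K hK
  refine isOpen_iff_mem_nhds.2 fun x hx => ?_
  have hxU : (fun y => x⁻¹ * y) ⁻¹' (U : Set G) ∈ 𝓝 x :=
    (U.isOpen.preimage (continuous_const_mul x⁻¹)).mem_nhds (by simp)
  refine mem_of_superset hxU fun y hy χ hχ => ?_
  have h1 : χ (x⁻¹ * y) = 1 := hU χ hχ _ hy
  have h2 : χ y = χ x := by rwa [map_mul, map_inv, inv_mul_eq_one, eq_comm] at h1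
  change χ y ∈ V
  rw [h2]
  exact hx hχ

/-- An open subgroup evaluating `K` into the arc is sent by each `χ ∈ K` to a subgroup inside the
arc, which is trivial. -/
theorem HasLocallyTrivialCompacts.of_continuous_bidualEval {G : Type*} [CommGroup G]
    [TopologicalSpace G] [IsTopologicalGroup G] (hG : IsPSpace G)
    (h : Continuous (bidualEval G)) : HasLocallyTrivialCompacts G := by
  intro K hK
  have hO : IsOpen {ψ : PontryaginDual (PontryaginDual G) |
      MapsTo ψ K (Circle.centeredArc (Real.pi / 2))} :=
    isOpen_induced (ContinuousMap.isOpen_setOfPred_mapsTo hK (Circle.isOpen_centeredArc _))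
  obtain ⟨U, hU⟩ := hG.exists_openSubgroup_subset ((hO.preimage h).mem_nhds (x := 1) (by
    intro χ _
    rw [map_one]
    exact mem_of_mem_nhds circle_arc_mem_nhds_one))
  refine ⟨U, fun χ hχ u hu =>
    Circle.eq_one_of_forall_pow_mem_centeredArc_pi_div_two fun n _ => ?_⟩
  rw [← map_pow]
  exact hU (pow_mem hu n) hχ

/-- A `T₁` `P`-group whose dual has locally trivial compact sets is reflexive. -/
theorem HasLocallyTrivialCompacts.isReflexiveGroup {G : Type*} [CommGroup G]
    [TopologicalSpace G] [IsTopologicalGroup G] [T1Space G] (hG : IsPSpace G)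
    (h : HasLocallyTrivialCompacts G) : IsReflexiveGroup G :=
  ⟨h.continuous_bidualEval, bidualEval_isOpenMap_of_isPSpace hG,
    bidualEval_injective_of_isPSpace hG, bidualEval_surjective_of_isPSpace hG⟩

/-- The continuous character of `G ⧸ H` given by a homomorphism that agrees, on an open subgroup,
with a continuous character of `G`. -/
def quotientCharacter {G : Type*} [CommGroup G] [TopologicalSpace G]
    [IsTopologicalGroup G] (H : Subgroup G) (U : OpenSubgroup G) (κ : PontryaginDual G)
    (g : G ⧸ H →* Circle) (hg : ∀ u ∈ U, g (u : G ⧸ H) = κ u) : PontryaginDual (G ⧸ H) :=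
  (⟨g, by
    refine QuotientGroup.isOpenQuotientMap_mk.isQuotientMap.continuous_iff.2 ?_
    refine continuous_of_continuousAt_one (g.comp (QuotientGroup.mk' H)) ?_
    refine (map_continuous κ).continuousAt.congr ?_
    filter_upwards [U.isOpen.mem_nhds U.one_mem] with u hu
    exact (hg u hu).symm⟩ : G ⧸ H →ₜ* Circle)

/-- The characters of `G ⧸ H` agreeing on an open subgroup with a member of a compact set of
characters of `G` form a compact set. -/
theorem isCompact_quotient_characters {G : Type*} [CommGroup G] [TopologicalSpace G]
    [IsTopologicalGroup G] (H : Subgroup G) [T1Space (G ⧸ H)] (hQ : IsPSpace (G ⧸ H))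
    (U : OpenSubgroup G) {K : Set (PontryaginDual G)} (hK : IsCompact K) :
    IsCompact {χ : PontryaginDual (G ⧸ H) | ∃ κ ∈ K, ∀ u ∈ U, χ (u : G ⧸ H) = κ u} := by
  rw [(PontryaginDual.isEmbedding_coe_of_isPSpace hQ).isCompact_iff]
  let K' : Set (U → Circle) := (fun (κ : PontryaginDual G) (u : U) => κ (u : G)) '' K
  have hK' : IsClosed K' := (hK.image
    (continuous_pi fun u : U => continuous_eval_const (F := G →ₜ* Circle) (u : G))).isClosed
  have hhom : IsClosed {f : G ⧸ H → Circle | ∀ x y, f (x * y) = f x * f y} := by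
    simp only [ofPred_forall]
    exact isClosed_iInter fun x => isClosed_iInter fun y =>
      isClosed_eq (continuous_apply _) ((continuous_apply x).mul (continuous_apply y))
  have hres : Continuous fun (f : G ⧸ H → Circle) (u : U) => f ((u : G) : G ⧸ H) :=
    continuous_pi fun u => continuous_apply _
  -- Continuity of the limit need not be imposed: agreement with some `κ` on `U` forces it.
  have hcl := hhom.inter (hK'.preimage hres)
  convert hcl.isCompact using 1
  ext f
  constructor
  · rintro ⟨χ, ⟨κ, hκ, h⟩, rfl⟩
    exact ⟨fun x y => map_mul χ x y, κ, hκ, funext fun u => (h u u.2).symm⟩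
  · rintro ⟨hf, κ, hκ, h⟩
    have hg (u : G) (hu : u ∈ U) : MonoidHom.mk' f hf (u : G ⧸ H) = κ u :=
      (congrFun h ⟨u, hu⟩).symm
    exact ⟨quotientCharacter H U κ (MonoidHom.mk' f hf) hg, ⟨κ, hκ, hg⟩, rfl⟩

theorem HasLocallyTrivialCompacts.of_subgroup_of_quotient {G : Type*} [CommGroup G]
    [TopologicalSpace G] [IsTopologicalGroup G] (hG : IsPSpace G) (H : Subgroup G)
    [T1Space (G ⧸ H)] (hQ : IsPSpace (G ⧸ H)) (h1 : HasLocallyTrivialCompacts H)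
    (h2 : HasLocallyTrivialCompacts (G ⧸ H)) : HasLocallyTrivialCompacts G := by
  intro K hK
  let ι : H →ₜ* G := ⟨H.subtype, continuous_subtype_val⟩
  obtain ⟨V, hV⟩ := h1 _ (hK.image (map_continuous (PontryaginDual.map ι)))
  obtain ⟨s, hs, hsV⟩ := mem_nhds_subtype _ _ _ |>.1 (V.isOpen.mem_nhds V.one_mem)
  obtain ⟨U, hU⟩ := hG.exists_openSubgroup_subset hs
  obtain ⟨W, hW⟩ := h2 _ (isCompact_quotient_characters H hQ U hK)
  refine ⟨U ⊓ W.comap (QuotientGroup.mk' H) QuotientGroup.continuous_mk, fun κ hκ w hw => ?_⟩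
  obtain ⟨hwU, hwW⟩ := hw
  let j : (U : Subgroup G) →* G ⧸ H := (QuotientGroup.mk' H).comp (U : Subgroup G).subtype
  -- The kernel of `j` is `U ∩ H`, which lies in `V`, where `κ` is trivial.
  obtain ⟨g, hg⟩ := MonoidHom.exists_circle_extension_of_ker_le j
    (((κ : G →ₜ* Circle) : G →* Circle).comp (U : Subgroup G).subtype) fun u hu => by
      have huH : (u : G) ∈ H := (QuotientGroup.eq_one_iff (u : G)).1 hu
      exact hV _ ⟨κ, hκ, rfl⟩ ⟨u, huH⟩ (hsV (hU u.2))
  have hg' (u : G) (hu : u ∈ U) : g (u : G ⧸ H) = κ u := hg ⟨u, hu⟩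
  exact (hg' w hwU).symm.trans (hW (quotientCharacter H U κ g hg') ⟨κ, hκ, hg'⟩ _ hwW)

theorem IsReflexiveGroup.t2Space {G : Type*} [CommGroup G] [TopologicalSpace G]
    (h : IsReflexiveGroup G) : T2Space G :=
  (IsHomeomorph.isEmbedding h).t2Space

theorem mainTheorem2 {G : Type*} [CommGroup G] [TopologicalSpace G] [IsTopologicalGroup G]
    (H : Subgroup G) (hH : IsClosed (H : Set G))
    (hHrefl : IsReflexivePGroup H) (hQrefl : IsReflexivePGroup (G ⧸ H)) :
    IsReflexivePGroup G := by
  obtain ⟨hHr, hHP⟩ := hHrefl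
  obtain ⟨hQr, hQP⟩ := hQrefl
  have : T2Space H := hHr.t2Space
  have : T2Space (G ⧸ H) := hQr.t2Space
  have : T2Space G := t2Space_of_isClosed_subgroup H hH
  have hG : IsPSpace G := isPSpace_of_subgroup_of_quotient H hHP hQP
  have h1 : HasLocallyTrivialCompacts H := .of_continuous_bidualEval hHP hHr.continuous
  have h2 : HasLocallyTrivialCompacts (G ⧸ H) := .of_continuous_bidualEval hQP hQr.continuous
  exact ⟨(HasLocallyTrivialCompacts.of_subgroup_of_quotient hG H hQP h1 h2).isReflexiveGroup hG, hG⟩
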